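/- Let $\mathrm{FI}$ be the category of finite sets and injections, and let an FI-module be a functor $W\colon \mathrm{FI}\to \mathbb{Z}\text{-Mod}$ (not necessarily finitely generated); write $W_T=W(T)$ and $W_n=W(\{1,\dots,n\})$. The degree $\deg W\in\{-\infty\}\cup\mathbb{N}\cup\{\infty\}$ of an FI-module is the infimum of all $k\in\{-\infty\}\cup\mathbb{N}\cup\{\infty\}$ such that $W_n=0$ for all $n\in\mathbb{N}$ with $n>k$. Let $H_0$ be the functor from FI-modules to FI-modules given by $$H_0(W)_T = W_T\,/\,\operatorname{span}\big(\operatorname{im}(f_*\colon W_S\to W_T)\ \big|\ f\colon S\hookrightarrow T,\ |S|<|T|\big),$$ and for $p\ge 0$ let $H_p$ be the $p$-th left derived functor of $H_0$. Let $W$ be an FI-module and let $k,d\in\{-\infty\}\cup\mathbb{N}$ be such that $\deg H_0(W)\le k$ and $\deg H_1(W)\le d$. Then $W$ has Castelnuovo--Mumford regularity at most $k+d-1$; that is, for every $p>0$, $$\deg H_p(W)\le p+k+d-1,$$ where the right-hand side is $-\infty$ if $k=-\infty$ or $d=-\infty$. -/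

import Mathlib

open CategoryTheory

/-- The objects of the category FI: finite sets. -/
structure FI : Type 1 where
  carrier : Type
  [finite : Finite carrier]

namespace FI

instance : CoeSort FI Type := ⟨FI.carrier⟩

instance (T : FI) : Finite T := T.finite

/-- The morphisms of FI are the injections. -/
instance : Category FI where
  Hom S T := S ↪ T
  id T := Function.Embedding.refl T
  comp f g := f.trans g

/-- The standard set with `n` elements. -/
def std (n : ℕ) : FI := ⟨Fin n⟩

theorem card_le_of_hom {S T : FI} (f : S ⟶ T) : Nat.card S ≤ Nat.card T :=
  Nat.card_le_card_of_injective (fun x : S => (show S ↪ T from f) x)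
    (show S ↪ T from f).injective

end FI

universe u

/-- FI-modules over a commutative ring `R`: functors from FI to `R`-modules. -/
abbrev FIModule (R : Type) [CommRing R] : Type (u + 1) := FI ⥤ ModuleCat.{u} R

namespace FIModule

section

variable {R : Type} [CommRing R]

/-- The degree of an FI-module, an element of `{-∞} ∪ ℕ ∪ {∞}`: the infimum of all `k` such that
`W_n = 0` for every natural number `n > k`. -/
noncomputable def deg (W : FIModule.{u} R) : WithBot ℕ∞ :=
  sInf {k : WithBot ℕ∞ | ∀ n : ℕ, k < (n : WithBot ℕ∞) → Subsingleton (W.obj (FI.std n))}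

/-- The span in `W_T` of the images of all `f_* : W_S → W_T` with `|S| < |T|`. -/
def lower (W : FIModule.{u} R) (T : FI) : Submodule R (W.obj T) :=
  Submodule.span R {x | ∃ (S : FI) (f : S ⟶ T) (y : W.obj S),
    Nat.card S < Nat.card T ∧ (W.map f).hom y = x}

theorem lower_le_comap_map (W : FIModule.{u} R) {T T' : FI} (g : T ⟶ T') :
    W.lower T ≤ (W.lower T').comap (W.map g).hom := by
  refine Submodule.span_le.2 ?_
  rintro _ ⟨S, f, y, h, rfl⟩
  exact Submodule.subset_span
    ⟨S, f ≫ g, y, h.trans_le (FI.card_le_of_hom g), by simp⟩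

theorem lower_le_comap_app {V W : FIModule.{u} R} (φ : V ⟶ W) (T : FI) :
    V.lower T ≤ (W.lower T).comap (φ.app T).hom := by
  refine Submodule.span_le.2 ?_
  rintro _ ⟨S, f, y, h, rfl⟩
  refine Submodule.subset_span ⟨S, f, (φ.app S).hom y, h, ?_⟩
  exact (NatTrans.naturality_apply φ f y).symm

/-- `H₀(W)_T` is the quotient of `W_T` by the span of the images of all `f_* : W_S → W_T`
with `|S| < |T|`. -/
def H0Obj (W : FIModule.{u} R) : FIModule.{u} R where
  obj T := ModuleCat.of R (W.obj T ⧸ W.lower T)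
  map {T T'} g := ModuleCat.ofHom
    (Submodule.mapQ (W.lower T) (W.lower T') (W.map g).hom (W.lower_le_comap_map g))
  map_id T := by
    apply ModuleCat.hom_ext
    refine Submodule.linearMap_qext _ (LinearMap.ext fun x => ?_)
    simp
  map_comp f g := by
    apply ModuleCat.hom_ext
    refine Submodule.linearMap_qext _ (LinearMap.ext fun x => ?_)
    simp

/-- The map `H₀(V) ⟶ H₀(W)` induced by a map `V ⟶ W` of FI-modules. -/
def H0Map {V W : FIModule.{u} R} (φ : V ⟶ W) : H0Obj V ⟶ H0Obj W where
  app T := ModuleCat.ofHom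
    (Submodule.mapQ (V.lower T) (W.lower T) (φ.app T).hom (lower_le_comap_app φ T))
  naturality {T T'} g := by
    apply ModuleCat.hom_ext
    refine Submodule.linearMap_qext _ (LinearMap.ext fun x => ?_)
    exact congrArg (Submodule.Quotient.mk (p := W.lower T')) (NatTrans.naturality_apply φ g x)

variable (R) in
/-- The functor `H₀` from FI-modules to FI-modules. -/
def H0 : FIModule.{u} R ⥤ FIModule.{u} R where
  obj := H0Obj
  map := H0Map
  map_id W := by
    ext T : 2
    apply ModuleCat.hom_ext
    exact Submodule.linearMap_qext _ (LinearMap.ext fun x => rfl)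
  map_comp φ ψ := by
    ext T : 2
    apply ModuleCat.hom_ext
    exact Submodule.linearMap_qext _ (LinearMap.ext fun x => rfl)

instance : (H0.{u} R).Additive where
  map_add {V W φ ψ} := by
    ext T : 2
    apply ModuleCat.hom_ext
    exact Submodule.linearMap_qext _ (LinearMap.ext fun x => rfl)

/-- An FI-module that is a direct sum of representable ones, with one summand
`R[Hom([n], -)]` for each `n` and each element of `W_n`. -/
noncomputable def freeCover (W : FIModule.{u} R) : FIModule.{u} R where
  obj T := ModuleCat.of R ((Σ n : ℕ, W.obj (FI.std n) × (FI.std n ⟶ T)) →₀ R)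
  map {T T'} g := ModuleCat.ofHom
    (Finsupp.lmapDomain R R (fun a => ⟨a.1, a.2.1, a.2.2 ≫ g⟩))
  map_id T := by
    ext a
    simp
  map_comp f g := by
    ext a
    simp

/-- The map out of `freeCover W` that sends the generator for `w ∈ W_n` to `v n w`. -/
noncomputable def freeCoverLift (W X : FIModule.{u} R)
    (v : ∀ n : ℕ, W.obj (FI.std n) → X.obj (FI.std n)) : freeCover W ⟶ X where
  app T := ModuleCat.ofHom
    (Finsupp.linearCombination R (fun a => (X.map a.2.2).hom (v a.1 a.2.1)))
  naturality {T T'} g := by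
    apply ModuleCat.hom_ext
    refine Finsupp.lhom_ext' fun a => LinearMap.ext_ring ?_
    simp [freeCover]

theorem freeCoverLift_single (W X : FIModule.{u} R)
    (v : ∀ n : ℕ, W.obj (FI.std n) → X.obj (FI.std n)) (T : FI) (n : ℕ)
    (a : W.obj (FI.std n) × (FI.std n ⟶ T)) :
    ((freeCoverLift W X v).app T).hom (Finsupp.single ⟨n, a⟩ 1) =
      (X.map a.2).hom (v n a.1) :=
  (Finsupp.linearCombination_single _ _ _).trans (one_smul R _)

theorem freeCover_hom_ext {W X : FIModule.{u} R} {φ ψ : freeCover W ⟶ X}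
    (h : ∀ (n : ℕ) (w : W.obj (FI.std n)),
      (φ.app (FI.std n)).hom (Finsupp.single ⟨n, w, 𝟙 _⟩ 1) =
        (ψ.app (FI.std n)).hom (Finsupp.single ⟨n, w, 𝟙 _⟩ 1)) : φ = ψ := by
  ext T : 2
  apply ModuleCat.hom_ext
  refine Finsupp.lhom_ext' fun a => LinearMap.ext_ring ?_
  obtain ⟨n, w, f⟩ := a
  have key : ∀ χ : freeCover W ⟶ X, (χ.app T).hom (Finsupp.single ⟨n, w, f⟩ 1) =
      (X.map f).hom ((χ.app (FI.std n)).hom (Finsupp.single ⟨n, w, 𝟙 _⟩ 1)) := by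
    intro χ
    have := NatTrans.naturality_apply χ f (Finsupp.single ⟨n, w, 𝟙 _⟩ 1)
    refine Eq.trans ?_ this
    refine congrArg (χ.app T).hom ?_
    exact ((Finsupp.mapDomain_single (f := fun a : (Σ m : ℕ, W.obj (FI.std m) ×
      (FI.std m ⟶ FI.std n)) => (⟨a.1, a.2.1, a.2.2 ≫ f⟩ :
        Σ m : ℕ, W.obj (FI.std m) × (FI.std m ⟶ T)))).trans (by simp)).symm
  exact (key φ).trans ((congrArg _ (h n w)).trans (key ψ).symm)

theorem app_surjective_of_epi {E X : FIModule.{u} R} (e : E ⟶ X) [Epi e] (T : FI) :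
    Function.Surjective (e.app T) :=
  (ModuleCat.epi_iff_surjective _).1 inferInstance

instance (W : FIModule.{u} R) : Projective (freeCover W) where
  factors {E X} f e he := by
    choose s hs using fun T => app_surjective_of_epi e T
    refine ⟨freeCoverLift W E fun n w =>
      s _ ((f.app (FI.std n)).hom (Finsupp.single ⟨n, w, 𝟙 _⟩ 1)), ?_⟩
    refine freeCover_hom_ext fun n w => ?_
    refine Eq.trans (congrArg (e.app (FI.std n)).hom ?_) (hs _ _)
    refine (freeCoverLift_single W E _ _ _ _).trans ?_
    simp

theorem exists_iso_std (T : FI) : ∃ n : ℕ, Nonempty (FI.std n ≅ T) := by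
  obtain ⟨n, ⟨e⟩⟩ := Finite.exists_equiv_fin T
  refine ⟨n, ⟨⟨e.symm.toEmbedding, e.toEmbedding, ?_, ?_⟩⟩⟩
  · exact Function.Embedding.ext fun x => e.apply_symm_apply x
  · exact Function.Embedding.ext fun x => e.symm_apply_apply x

/-- The category of FI-modules has enough projectives, so left derived functors exist. -/
instance : EnoughProjectives (FIModule.{u} R) where
  presentation W := ⟨{
    p := freeCover W
    f := freeCoverLift W W fun _ w => w
    epi := by
      have : ∀ T, Epi ((freeCoverLift W W fun _ w => w).app T) := by
        intro T
        rw [ModuleCat.epi_iff_surjective]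
        intro x
        obtain ⟨n, ⟨i⟩⟩ := exists_iso_std T
        refine ⟨Finsupp.single ⟨n, (W.map i.inv).hom x, i.hom⟩ 1, ?_⟩
        refine (freeCoverLift_single W W _ _ _ _).trans ?_
        exact ConcreteCategory.congr_hom (W.mapIso i).inv_hom_id x
      exact NatTrans.epi_of_epi_app _ }⟩

variable (R) in
/-- FI-homology: `H p` is the `p`-th left derived functor of `H0`. -/
noncomputable def H (p : ℕ) : FIModule.{u} R ⥤ FIModule.{u} R :=
  (H0.{u} R).leftDerived p

end

end FIModule

/-! FI-homology is computed by Koszul complexes. In cardinality n, the complex of V is the n-fold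
iterated mapping cone of V → SV, evaluated at the empty set, where (SV)_T = V_{T ⊔ {∗}}. Its degree
zero homology is H₀(V)_n (`koszulVanishes_zero_iff`), and it has no positive homology on free
modules, because there V → SV is injective with free cokernel (`koszulVanishes_freeOn`). Dimension
shifting then yields `subsingleton_H_obj_iff`.

Let K and D be the kernel and cokernel of V → SV. The cone gives exact sequences H_{p-1}(K)_n →
H_p(V)_{n+1} → H_p(D)_n → H_{p-2}(K)_n → H_{p-1}(V)_{n+1}. Hence the bounds on H₀ and H₁ both drop
by one from V to D, and `koszulVanishes_of_le` inducts on the bound for H₀. The induction controls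
H₂(D), which together with H₁(V) controls H₀(K). Non-bijective injections act by zero on K, so H₀(K)
= K and K itself vanishes in high cardinalities. Feeding K and D back into the sequence bounds every
H_p(V) with p > 0. -/

namespace FI

/-! ### Adding a point to finite sets. -/

/-- The functor `T ↦ T ⊔ {∗}` from FI to itself. -/
def shift : FI ⥤ FI where
  obj T := ⟨Option T⟩
  map f := Function.Embedding.optionMap f
  map_id T := Function.Embedding.ext fun x => by cases x <;> rfl
  map_comp f g := Function.Embedding.ext fun x => by cases x <;> rfl

/-- The inclusion of `T` into `T ⊔ {∗}`. -/
def incl (T : FI) : T ⟶ shift.obj T := (Function.Embedding.some : T ↪ Option T)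

theorem incl_naturality {S T : FI} (f : S ⟶ T) : f ≫ incl T = incl S ≫ shift.map f := rfl

/-- A set with `n` elements, obtained from the empty set by adding points. -/
def iter : ℕ → FI
  | 0 => ⟨Empty⟩
  | n + 1 => shift.obj (iter n)

theorem card_shift (T : FI) : Nat.card (shift.obj T) = Nat.card T + 1 :=
  Finite.card_option

theorem card_iter (n : ℕ) : Nat.card (iter n) = n := by
  induction n with
  | zero => exact Nat.card_of_isEmpty (α := Empty)
  | succ n ih => exact (card_shift _).trans (congrArg (· + 1) ih)

theorem nonempty_iso_of_card_eq {S T : FI} (h : Nat.card S = Nat.card T) : Nonempty (S ≅ T) := by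
  obtain ⟨e⟩ := Finite.card_eq.1 h
  exact ⟨⟨e.toEmbedding, e.symm.toEmbedding,
    Function.Embedding.ext fun x => e.symm_apply_apply x,
    Function.Embedding.ext fun x => e.apply_symm_apply x⟩⟩

/-- An injection into a bigger set factors through the inclusion `S ⟶ S ⊔ {∗}`. -/
theorem exists_eq_incl_comp {S T : FI} (f : S ⟶ T) (h : Nat.card S < Nat.card T) :
    ∃ g : shift.obj S ⟶ T, f = incl S ≫ g := by
  obtain ⟨t, ht⟩ : ∃ t : T, t ∉ Set.range (show S ↪ T from f) := by
    by_contra! hs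
    exact h.not_ge (Nat.card_le_card_of_surjective (show S ↪ T from f) hs)
  exact ⟨Function.Embedding.optionElim (show S ↪ T from f) t ht, rfl⟩

/-- An injection into `T ⊔ {∗}` either has image in `T`, or comes from an injection into `T`
by adding a point. -/
theorem hom_shift_cases {S T : FI} (f : S ⟶ shift.obj T) :
    (∃ g : S ⟶ T, f = g ≫ incl T) ∨
      ∃ (S' : FI) (i : S ⟶ shift.obj S') (g : S' ⟶ T), Nat.card S = Nat.card S' + 1 ∧
        f = i ≫ shift.map g := by
  let f' : S ↪ Option T := f
  by_cases h : ∃ s, f' s = none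
  · right
    obtain ⟨s, hs⟩ := h
    have hne : ∀ x : {x // x ≠ s}, f' x ≠ none := fun x hx =>
      x.2 (f'.injective (hx.trans hs.symm))
    have hsome : ∀ x : {x // x ≠ s}, ∃ t, f' x = some t := fun x =>
      Option.ne_none_iff_exists'.1 (hne x)
    choose g hg using hsome
    classical
    let S' : FI := ⟨{x : S // x ≠ s}⟩
    let e : Option {x : S // x ≠ s} ≃ S := Equiv.optionSubtypeNe s
    refine ⟨S', e.symm.toEmbedding, ⟨g, fun x y hxy => Subtype.ext (f'.injective ?_)⟩, ?_, ?_⟩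
    · rw [hg, hg, hxy]
    · exact (Nat.card_congr e.symm).trans (card_shift S')
    · refine Function.Embedding.ext fun x => ?_
      obtain ⟨y, rfl⟩ := e.surjective x
      change f' (e y) = Option.map g (e.symm (e y))
      rw [Equiv.symm_apply_apply]
      cases y with
      | none => exact hs
      | some y => exact hg y
  · left
    push Not at h
    have hsome : ∀ x, ∃ t, f' x = some t := fun x => Option.ne_none_iff_exists'.1 (h x)
    choose g hg using hsome
    refine ⟨⟨g, fun x y hxy => f'.injective (by rw [hg, hg, hxy])⟩, ?_⟩
    exact Function.Embedding.ext fun x => hg x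

end FI

/-! ### The shift and the Koszul complexes. -/

namespace FIModule

variable {R : Type} [CommRing R]

theorem map_comp_hom_apply (V : FIModule.{u} R) {S T U : FI} (f : S ⟶ T) (g : T ⟶ U)
    (x : V.obj S) : (V.map (f ≫ g)).hom x = (V.map g).hom ((V.map f).hom x) := by
  rw [V.map_comp]; rfl

theorem subsingleton_obj_of_card_eq (V : FIModule.{u} R) {S T : FI}
    (h : Nat.card S = Nat.card T) [Subsingleton (V.obj S)] : Subsingleton (V.obj T) := by
  obtain ⟨e⟩ := FI.nonempty_iso_of_card_eq h
  exact (V.mapIso e).toLinearEquiv.symm.toEquiv.subsingleton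

variable (R) in
/-- The shift functor on FI-modules: `(SV)_T = V_{T ⊔ {∗}}`. -/
abbrev shift : FIModule.{u} R ⥤ FIModule.{u} R :=
  (Functor.whiskeringLeft FI FI (ModuleCat.{u} R)).obj FI.shift

/-- The natural map from an FI-module to its shift. -/
def toShift (V : FIModule.{u} R) : V ⟶ (shift R).obj V where
  app T := V.map (FI.incl T)
  naturality {S T} f := by
    change V.map f ≫ V.map _ = V.map _ ≫ V.map (FI.shift.map f)
    rw [← V.map_comp, ← V.map_comp, FI.incl_naturality]

theorem toShift_naturality {V W : FIModule.{u} R} (φ : V ⟶ W) :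
    φ ≫ toShift W = toShift V ≫ (shift R).map φ := by
  ext T : 2
  exact (φ.naturality (FI.incl T)).symm

/-- The functor sending `V` to the product of `F(V)` and `G(V)`. -/
def prodFunctor (F G : FIModule.{u} R ⥤ ModuleCat.{u} R) :
    FIModule.{u} R ⥤ ModuleCat.{u} R where
  obj V := ModuleCat.of R (F.obj V × G.obj V)
  map φ := ModuleCat.ofHom ((F.map φ).hom.prodMap (G.map φ).hom)
  map_id V := by ext x <;> simp
  map_comp φ ψ := by ext x <;> simp

variable (R) in
/-- The terms of the Koszul complexes of FI-modules, built as iterated mapping cones of the maps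
`V ⟶ SV`: `koszul R n (p + 1)` is the term of degree `p` computing the homology in cardinality
`n`, and the term `koszul R n 0` of degree `-1` vanishes. -/
def koszul : ℕ → ℕ → FIModule.{u} R ⥤ ModuleCat.{u} R
  | 0, 1 => (evaluation _ _).obj (FI.iter 0)
  | 0, 0 => (Functor.const _).obj (ModuleCat.of R PUnit)
  | 0, _ + 2 => (Functor.const _).obj (ModuleCat.of R PUnit)
  | _ + 1, 0 => (Functor.const _).obj (ModuleCat.of R PUnit)
  | n + 1, p + 1 => prodFunctor (shift R ⋙ koszul n (p + 1)) (koszul n p)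

instance (n : ℕ) (V : FIModule.{u} R) : Subsingleton ((koszul R n 0).obj V) := by
  cases n <;> exact inferInstanceAs (Subsingleton PUnit)

instance (p : ℕ) (V : FIModule.{u} R) : Subsingleton ((koszul R 0 (p + 2)).obj V) :=
  inferInstanceAs (Subsingleton PUnit)

/-- The map of Koszul terms induced by a map of FI-modules. -/
def koszulMap (n p : ℕ) {V W : FIModule.{u} R} (φ : V ⟶ W) :
    (koszul R n p).obj V →ₗ[R] (koszul R n p).obj W :=
  ((koszul R n p).map φ).hom

theorem koszulMap_comp (n p : ℕ) {U V W : FIModule.{u} R} (φ : U ⟶ V) (ψ : V ⟶ W)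
    (x : (koszul R n p).obj U) :
    koszulMap n p (φ ≫ ψ) x = koszulMap n p ψ (koszulMap n p φ x) := by
  simp [koszulMap]

theorem koszulMap_id (n p : ℕ) {V : FIModule.{u} R} (x : (koszul R n p).obj V) :
    koszulMap n p (𝟙 V) x = x := by
  simp [koszulMap]

theorem koszulMap_succ (n p : ℕ) {V W : FIModule.{u} R} (φ : V ⟶ W)
    (x : (koszul R n (p + 1)).obj ((shift R).obj V)) (y : (koszul R n p).obj V) :
    koszulMap (n + 1) (p + 1) φ (x, y) =
      (koszulMap n (p + 1) ((shift R).map φ) x, koszulMap n p φ y) := rfl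

/-- The differential of the Koszul complex. -/
def koszulD : (n p : ℕ) → (V : FIModule.{u} R) →
    (koszul R n (p + 1)).obj V →ₗ[R] (koszul R n p).obj V
  | 0, _, _ => 0
  | _ + 1, 0, _ => 0
  | n + 1, p + 1, V =>
    -- The mapping cone differential; the sign on the V-summand makes it square to zero.
    ((koszulD n (p + 1) ((shift R).obj V)).coprod (koszulMap n (p + 1) (toShift V))).prod
      (-((koszulD n p V).comp (LinearMap.snd R _ _)))

theorem koszulD_succ (n p : ℕ) (V : FIModule.{u} R)
    (x : (koszul R n (p + 2)).obj ((shift R).obj V)) (y : (koszul R n (p + 1)).obj V) :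
    koszulD (n + 1) (p + 1) V (x, y) =
      (koszulD n (p + 1) _ x + koszulMap n (p + 1) (toShift V) y, -koszulD n p V y) := rfl

theorem koszulD_naturality (n p : ℕ) {V W : FIModule.{u} R} (φ : V ⟶ W)
    (x : (koszul R n (p + 1)).obj V) :
    koszulD n p W (koszulMap n (p + 1) φ x) = koszulMap n p φ (koszulD n p V x) := by
  induction n generalizing p V W with
  | zero => exact (map_zero (koszulMap 0 p φ)).symm
  | succ n ih =>
    cases p with
    | zero => exact Subsingleton.elim _ _
    | succ p =>
      obtain ⟨x, y⟩ := x
      rw [koszulMap_succ, koszulD_succ, koszulD_succ, koszulMap_succ, ih, ih,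
        ← koszulMap_comp, toShift_naturality, koszulMap_comp, map_add, map_neg]

theorem koszulD_comp_koszulD (n p : ℕ) (V : FIModule.{u} R) (x : (koszul R n (p + 2)).obj V) :
    koszulD n p V (koszulD n (p + 1) V x) = 0 := by
  induction n generalizing p V with
  | zero => rfl
  | succ n ih =>
    cases p with
    | zero => rfl
    | succ p =>
      obtain ⟨x, y⟩ := x
      rw [koszulD_succ, koszulD_succ, map_add, ih, koszulD_naturality, map_neg, map_neg, ih,
        zero_add, add_neg_cancel, neg_zero, neg_zero]
      rfl

/-! ### Exactness of the Koszul terms. -/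

theorem koszulMap_injective (n p : ℕ) {V W : FIModule.{u} R} (φ : V ⟶ W)
    (h : ∀ T, Function.Injective (φ.app T)) : Function.Injective (koszulMap n p φ) := by
  induction n generalizing p V W with
  | zero =>
    match p with
    | 0 => exact Function.injective_of_subsingleton _
    | 1 => exact h _
    | p + 2 => exact Function.injective_of_subsingleton _
  | succ n ih =>
    cases p with
    | zero => exact Function.injective_of_subsingleton _
    | succ p => exact (ih _ ((shift R).map φ) fun T => h _).prodMap (ih _ φ h)

theorem koszulMap_surjective (n p : ℕ) {V W : FIModule.{u} R} (φ : V ⟶ W)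
    (h : ∀ T, Function.Surjective (φ.app T)) : Function.Surjective (koszulMap n p φ) := by
  induction n generalizing p V W with
  | zero =>
    match p with
    | 0 => exact Function.surjective_to_subsingleton _
    | 1 => exact h _
    | p + 2 => exact Function.surjective_to_subsingleton _
  | succ n ih =>
    cases p with
    | zero => exact Function.surjective_to_subsingleton _
    | succ p => exact (ih _ ((shift R).map φ) fun T => h _).prodMap (ih _ φ h)

theorem koszulMap_exact (n p : ℕ) {U V W : FIModule.{u} R} (φ : U ⟶ V) (ψ : V ⟶ W)
    (h : ∀ T, Function.Exact (φ.app T) (ψ.app T)) :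
    Function.Exact (koszulMap n p φ) (koszulMap n p ψ) := by
  induction n generalizing p U V W with
  | zero =>
    match p with
    | 0 => exact fun x => ⟨fun _ => ⟨0, Subsingleton.elim _ _⟩, fun _ => Subsingleton.elim _ _⟩
    | 1 => exact h _
    | p + 2 =>
      exact fun x => ⟨fun _ => ⟨0, Subsingleton.elim _ _⟩, fun _ => Subsingleton.elim _ _⟩
  | succ n ih =>
    cases p with
    | zero =>
      exact fun x => ⟨fun _ => ⟨0, Subsingleton.elim _ _⟩, fun _ => Subsingleton.elim _ _⟩
    | succ p =>
      rintro ⟨x, y⟩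
      have h₁ := ih (p + 1) ((shift R).map φ) ((shift R).map ψ) (fun T => h _) x
      have h₂ := ih p φ ψ h y
      rw [koszulMap_succ]
      refine (Prod.mk_eq_zero.trans (and_congr h₁ h₂)).trans ?_
      constructor
      · rintro ⟨⟨a, rfl⟩, ⟨b, rfl⟩⟩
        exact ⟨(a, b), rfl⟩
      · rintro ⟨⟨a, b⟩, hab⟩
        exact ⟨⟨a, congrArg Prod.fst hab⟩, ⟨b, congrArg Prod.snd hab⟩⟩

/-- Each cone step either adds a point to the argument or raises the degree by one, so the degree p
term in cardinality n is a sum of copies of V_T with |T| = n - p. -/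
theorem koszul_subsingleton (n p : ℕ) (V : FIModule.{u} R)
    (h : ∀ T : FI, Nat.card T + p = n → Subsingleton (V.obj T)) :
    Subsingleton ((koszul R n (p + 1)).obj V) := by
  induction n generalizing p V with
  | zero =>
    cases p with
    | zero => exact h (FI.iter 0) (FI.card_iter 0)
    | succ p => infer_instance
  | succ n ih =>
    have h₁ : Subsingleton ((koszul R n (p + 1)).obj ((shift R).obj V)) :=
      ih p _ fun T hT => h _ (by rw [FI.card_shift]; omega)
    have h₂ : Subsingleton ((koszul R n p).obj V) := by
      cases p with
      | zero => infer_instance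
      | succ p => exact ih p _ fun T hT => h _ (by omega)
    exact @instSubsingletonProd _ _ h₁ h₂

/-- Vanishing of the degree `p` homology of the Koszul complex of `V` in cardinality `n`. -/
def KoszulVanishes (n p : ℕ) (V : FIModule.{u} R) : Prop :=
  ∀ x : (koszul R n (p + 1)).obj V, koszulD n p V x = 0 → ∃ y, koszulD n (p + 1) V y = x

theorem koszulVanishes_of_subsingleton {n p : ℕ} {V : FIModule.{u} R}
    (h : Subsingleton ((koszul R n (p + 1)).obj V)) : KoszulVanishes n p V :=
  fun _ _ => ⟨0, h.elim _ _⟩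

theorem KoszulVanishes.of_retract {n p : ℕ} {V W : FIModule.{u} R} (h : KoszulVanishes n p W)
    (i : V ⟶ W) (r : W ⟶ V) (hir : i ≫ r = 𝟙 V) : KoszulVanishes n p V := by
  intro x hx
  obtain ⟨y, hy⟩ := h (koszulMap n _ i x) (by rw [koszulD_naturality, hx, map_zero])
  exact ⟨koszulMap n _ r y, by
    rw [koszulD_naturality, hy, ← koszulMap_comp, hir, koszulMap_id]⟩

/-! ### Kernel and cokernel of V → SV. -/

section Shift

variable {n p : ℕ} {K V D : FIModule.{u} R} {i : K ⟶ V} {q : (shift R).obj V ⟶ D}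

/-- This and the next lemma are the surjections H_p(V)_{n+1} → H_p(D)_n for p = 0, 1, whose cokernel
embeds in H_{p-2}(K)_n = 0. -/
theorem koszulVanishes_zero_of_shift (hqs : ∀ T, Function.Surjective (q.app T))
    (hq : ∀ T, Function.Exact ((toShift V).app T) (q.app T))
    (h : KoszulVanishes (n + 1) 0 V) : KoszulVanishes n 0 D := by
  intro x hx
  obtain ⟨x, rfl⟩ := koszulMap_surjective n _ q hqs x
  obtain ⟨⟨w, v⟩, hwv⟩ := h (x, 0) rfl
  obtain rfl : koszulD n 1 _ w + koszulMap n 1 (toShift V) v = x := congrArg Prod.fst hwv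
  refine ⟨koszulMap n _ q w, ?_⟩
  rw [koszulD_naturality, map_add, (koszulMap_exact n _ _ _ hq).apply_apply_eq_zero, add_zero]

theorem koszulVanishes_one_of_shift (hqs : ∀ T, Function.Surjective (q.app T))
    (hq : ∀ T, Function.Exact ((toShift V).app T) (q.app T))
    (h : KoszulVanishes (n + 1) 1 V) : KoszulVanishes n 1 D := by
  intro x hx
  obtain ⟨x, rfl⟩ := koszulMap_surjective n _ q hqs x
  rw [koszulD_naturality] at hx
  obtain ⟨y, hy⟩ := (koszulMap_exact n _ _ _ hq _).1 hx
  -- The lift x need not be a cycle: its boundary comes from y in V, and pairing it with -y gives a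
  -- cycle of the cone.
  obtain ⟨⟨w, v⟩, hwv⟩ := h (x, -y) (by
    rw [koszulD_succ, map_neg, hy, add_neg_cancel]
    exact congrArg (Prod.mk 0) (Subsingleton.elim _ _))
  obtain rfl : koszulD n 2 _ w + koszulMap n 2 (toShift V) v = x := congrArg Prod.fst hwv
  refine ⟨koszulMap n _ q w, ?_⟩
  rw [koszulD_naturality, map_add, (koszulMap_exact n _ _ _ hq).apply_apply_eq_zero, add_zero]

/-- The relevant piece is H₂(D)_n → H₀(K)_n → H₁(V)_{n+1}, exact in the middle. -/
theorem koszulVanishes_ker_of_shift (his : ∀ T, Function.Injective (i.app T))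
    (hi : ∀ T, Function.Exact (i.app T) ((toShift V).app T))
    (hqs : ∀ T, Function.Surjective (q.app T))
    (hq : ∀ T, Function.Exact ((toShift V).app T) (q.app T))
    (h : KoszulVanishes (n + 1) 1 V) (hD : KoszulVanishes n 2 D) : KoszulVanishes n 0 K := by
  intro z hz
  obtain ⟨⟨w, v⟩, hwv⟩ := h (0, koszulMap n _ i z) (by
    rw [koszulD_succ, map_zero, (koszulMap_exact n _ _ _ hi).apply_apply_eq_zero, add_zero]
    exact congrArg (Prod.mk 0) (Subsingleton.elim _ _))
  change (koszul R n 3).obj ((shift R).obj V) at w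
  have h₁ : koszulD n 2 _ w + koszulMap n 2 (toShift V) v = 0 := congrArg Prod.fst hwv
  have h₂ : -koszulD n 1 _ v = koszulMap n _ i z := congrArg Prod.snd hwv
  obtain ⟨w', hw'⟩ := hD (koszulMap n _ q w) (by
    rw [koszulD_naturality, eq_neg_of_add_eq_zero_left h₁, map_neg,
      (koszulMap_exact n _ _ _ hq).apply_apply_eq_zero, neg_zero])
  obtain ⟨w', rfl⟩ := koszulMap_surjective n _ q hqs w'
  rw [koszulD_naturality] at hw'
  -- The chain v bounds i(z) up to sign but may lie outside K. Adding the boundary of v' leaves its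
  -- differential unchanged and makes it die in SV, hence lift to K.
  obtain ⟨v', hv'⟩ := (koszulMap_exact n _ _ _ hq (w - koszulD n _ _ w')).1 (by
    rw [map_sub, hw', sub_self])
  obtain ⟨t, ht⟩ := (koszulMap_exact n _ _ _ hi (v + koszulD n _ _ v')).1 (by
    rw [map_add, ← koszulD_naturality, hv', map_sub, koszulD_comp_koszulD, sub_zero, add_comm, h₁])
  refine ⟨-t, koszulMap_injective n _ i his ?_⟩
  rw [← h₂, ← koszulD_naturality, map_neg, map_neg, ht, map_add, koszulD_comp_koszulD, add_zero]

/-- This is exactness of H_p(K)_n → H_{p+1}(V)_{n+1} → H_{p+1}(D)_n: after subtracting a boundary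
obtained from D, a cycle of the cone comes from a cycle of K. -/
theorem KoszulVanishes.succ_of_ker_of_coker (his : ∀ T, Function.Injective (i.app T))
    (hi : ∀ T, Function.Exact (i.app T) ((toShift V).app T))
    (hqs : ∀ T, Function.Surjective (q.app T))
    (hq : ∀ T, Function.Exact ((toShift V).app T) (q.app T))
    (hD : KoszulVanishes n (p + 1) D) (hK : KoszulVanishes n p K) :
    KoszulVanishes (n + 1) (p + 1) V := by
  rintro ⟨x, y⟩ hxy
  change (koszul R n (p + 2)).obj ((shift R).obj V) at x
  have h₁ : koszulD n (p + 1) _ x + koszulMap n (p + 1) (toShift V) y = 0 :=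
    congrArg Prod.fst hxy
  have h₂ : -koszulD n p _ y = 0 := congrArg Prod.snd hxy
  obtain ⟨w, hw⟩ := hD (koszulMap n _ q x) (by
    rw [koszulD_naturality, eq_neg_of_add_eq_zero_left h₁, map_neg,
      (koszulMap_exact n _ _ _ hq).apply_apply_eq_zero, neg_zero])
  obtain ⟨w, rfl⟩ := koszulMap_surjective n _ q hqs w
  rw [koszulD_naturality] at hw
  obtain ⟨v, hv⟩ := (koszulMap_exact n _ _ _ hq (x - koszulD n _ _ w)).1 (by
    rw [map_sub, hw, sub_self])
  obtain ⟨z, hz⟩ := (koszulMap_exact n _ _ _ hi (y + koszulD n _ _ v)).1 (by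
    rw [map_add, ← koszulD_naturality, hv, map_sub, koszulD_comp_koszulD, sub_zero]
    exact (add_comm _ _).trans h₁)
  obtain ⟨t, rfl⟩ := hK z (by
    apply koszulMap_injective n p i his
    rw [← koszulD_naturality, hz, map_add, koszulD_comp_koszulD, neg_eq_zero.1 h₂, add_zero,
      map_zero])
  refine ⟨(w, v - koszulMap n _ i t), ?_⟩
  rw [koszulD_succ, map_sub, (koszulMap_exact n _ _ _ hi).apply_apply_eq_zero, sub_zero, hv,
    add_sub_cancel, map_sub, koszulD_naturality, hz, sub_add_cancel_right, neg_neg]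

end Shift

/-! ### Dimension shifting along short exact sequences. -/

section ShortExact

variable {n p : ℕ} {Z P V : FIModule.{u} R} {i : Z ⟶ P} {q : P ⟶ V}

/-- Dimension shifting for the Koszul homology. -/
theorem koszulVanishes_succ_iff (his : ∀ T, Function.Injective (i.app T))
    (hiq : ∀ T, Function.Exact (i.app T) (q.app T))
    (hqs : ∀ T, Function.Surjective (q.app T)) (hP : ∀ p, KoszulVanishes n (p + 1) P) :
    KoszulVanishes n (p + 2) V ↔ KoszulVanishes n (p + 1) Z := by
  constructor
  · intro h z hz
    obtain ⟨x, hx⟩ := hP p (koszulMap n _ i z) (by rw [koszulD_naturality, hz, map_zero])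
    obtain ⟨v, hv⟩ := h (koszulMap n _ q x) (by
      rw [koszulD_naturality, hx, (koszulMap_exact n _ _ _ hiq).apply_apply_eq_zero])
    obtain ⟨v, rfl⟩ := koszulMap_surjective n _ q hqs v
    rw [koszulD_naturality] at hv
    obtain ⟨w, hw⟩ := (koszulMap_exact n _ _ _ hiq (x - koszulD n _ _ v)).1 (by
      rw [map_sub, hv, sub_self])
    refine ⟨w, koszulMap_injective n _ i his ?_⟩
    rw [← koszulD_naturality, hw, map_sub, koszulD_comp_koszulD, sub_zero, hx]
  · intro h v hv
    obtain ⟨x, rfl⟩ := koszulMap_surjective n _ q hqs v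
    rw [koszulD_naturality] at hv
    obtain ⟨z, hz⟩ := (koszulMap_exact n _ _ _ hiq _).1 hv
    obtain ⟨w, rfl⟩ := h z (by
      apply koszulMap_injective n _ i his
      rw [← koszulD_naturality, hz, koszulD_comp_koszulD, map_zero])
    obtain ⟨y, hy⟩ := hP (p + 1) (x - koszulMap n _ i w) (by
      rw [map_sub, koszulD_naturality, hz, sub_self])
    refine ⟨koszulMap n _ q y, ?_⟩
    rw [koszulD_naturality, hy, map_sub, (koszulMap_exact n _ _ _ hiq).apply_apply_eq_zero,
      sub_zero]

/-- As H₁(P)_n = 0, the connecting map identifies H₁(V)_n with the kernel of H₀(Z)_n → H₀(P)_n. -/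
theorem koszulVanishes_one_iff (his : ∀ T, Function.Injective (i.app T))
    (hiq : ∀ T, Function.Exact (i.app T) (q.app T))
    (hqs : ∀ T, Function.Surjective (q.app T)) (hP : ∀ p, KoszulVanishes n (p + 1) P) :
    KoszulVanishes n 1 V ↔ ∀ z, koszulMap n 1 i z ∈ LinearMap.range (koszulD n 1 P) →
      z ∈ LinearMap.range (koszulD n 1 Z) := by
  constructor
  · rintro h z ⟨x, hx⟩
    obtain ⟨v, hv⟩ := h (koszulMap n _ q x) (by
      rw [koszulD_naturality, hx, (koszulMap_exact n _ _ _ hiq).apply_apply_eq_zero])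
    obtain ⟨v, rfl⟩ := koszulMap_surjective n _ q hqs v
    rw [koszulD_naturality] at hv
    obtain ⟨w, hw⟩ := (koszulMap_exact n _ _ _ hiq (x - koszulD n _ _ v)).1 (by
      rw [map_sub, hv, sub_self])
    refine ⟨w, koszulMap_injective n _ i his ?_⟩
    rw [← koszulD_naturality, hw, map_sub, koszulD_comp_koszulD, sub_zero, hx]
  · intro h v hv
    obtain ⟨x, rfl⟩ := koszulMap_surjective n _ q hqs v
    rw [koszulD_naturality] at hv
    obtain ⟨z, hz⟩ := (koszulMap_exact n _ _ _ hiq _).1 hv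
    obtain ⟨w, rfl⟩ := h z ⟨x, hz.symm⟩
    obtain ⟨y, hy⟩ := hP 0 (x - koszulMap n _ i w) (by
      rw [map_sub, koszulD_naturality, hz, sub_self])
    refine ⟨koszulMap n _ q y, ?_⟩
    rw [koszulD_naturality, hy, map_sub, (koszulMap_exact n _ _ _ hiq).apply_apply_eq_zero,
      sub_zero]

end ShortExact

/-! ### Koszul homology in degree zero. -/

/-- The term of degree zero of the Koszul complex is the value of the FI-module. -/
def toKoszul : (n : ℕ) → (V : FIModule.{u} R) → V.obj (FI.iter n) →ₗ[R] (koszul R n 1).obj V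
  | 0, _ => LinearMap.id
  | n + 1, V => (toKoszul n ((shift R).obj V)).prod 0

theorem toKoszul_bijective (n : ℕ) (V : FIModule.{u} R) : Function.Bijective (toKoszul n V) := by
  induction n generalizing V with
  | zero => exact Function.bijective_id
  | succ n ih =>
    refine ⟨fun x y h => (ih _).1 (congrArg Prod.fst h), fun ⟨x, y⟩ => ?_⟩
    obtain ⟨x, rfl⟩ := (ih ((shift R).obj V)).2 x
    exact ⟨x, congrArg (Prod.mk _) (Subsingleton.elim _ _)⟩

theorem koszulMap_toKoszul (n : ℕ) {V W : FIModule.{u} R} (φ : V ⟶ W) (x : V.obj (FI.iter n)) :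
    koszulMap n 1 φ (toKoszul n V x) = toKoszul n W ((φ.app _).hom x) := by
  induction n generalizing V W with
  | zero => rfl
  | succ n ih =>
    exact Prod.ext (ih ((shift R).map φ) x) (Subsingleton.elim _ _)

theorem map_mem_lower (V : FIModule.{u} R) {S T : FI} (f : S ⟶ T) (h : Nat.card S < Nat.card T)
    (x : V.obj S) : (V.map f).hom x ∈ V.lower T :=
  Submodule.subset_span ⟨S, f, x, h, rfl⟩

/-- An injection S → T ⊔ {∗} that misses ∗ factors through T. One that hits ∗ is, after deleting a
point of S, an injection from a smaller set into T, which contributes to SV. -/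
theorem lower_shift_obj (V : FIModule.{u} R) (T : FI) :
    V.lower (FI.shift.obj T) =
      ((shift R).obj V).lower T ⊔ LinearMap.range (V.map (FI.incl T)).hom := by
  apply le_antisymm
  · refine Submodule.span_le.2 ?_
    rintro _ ⟨S, f, y, h, rfl⟩
    rw [FI.card_shift] at h
    rcases FI.hom_shift_cases f with ⟨g, rfl⟩ | ⟨S', i, g, hS, rfl⟩
    · refine Submodule.mem_sup_right ⟨(V.map g).hom y, ?_⟩
      rw [map_comp_hom_apply]
    · refine Submodule.mem_sup_left ?_
      rw [map_comp_hom_apply]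
      exact map_mem_lower ((shift R).obj V) g (by omega) _
  · refine sup_le (Submodule.span_le.2 ?_) ?_
    · rintro _ ⟨S, f, y, h, rfl⟩
      exact map_mem_lower V (FI.shift.map f) (by rw [FI.card_shift, FI.card_shift]; omega) y
    · rintro _ ⟨y, rfl⟩
      exact map_mem_lower V _ (by rw [FI.card_shift]; omega) y

theorem mem_lower_shift_obj_iff (V : FIModule.{u} R) (T : FI) (x : V.obj (FI.shift.obj T)) :
    x ∈ V.lower (FI.shift.obj T) ↔
      ∃ t ∈ ((shift R).obj V).lower T, ∃ v, t + ((toShift V).app T).hom v = x := by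
  rw [lower_shift_obj]
  refine Submodule.mem_sup.trans ?_
  constructor
  · rintro ⟨t, ht, _, ⟨v, rfl⟩, hx⟩
    exact ⟨t, ht, v, hx⟩
  · rintro ⟨t, ht, v, hx⟩
    exact ⟨t, ht, _, ⟨v, rfl⟩, hx⟩

theorem toKoszul_mem_range_iff (n : ℕ) (V : FIModule.{u} R) (x : V.obj (FI.iter n)) :
    toKoszul n V x ∈ LinearMap.range (koszulD n 1 V) ↔ x ∈ V.lower (FI.iter n) := by
  induction n generalizing V with
  | zero =>
    have h₀ : V.lower (FI.iter 0) = ⊥ := by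
      refine (Submodule.span_eq_bot).2 ?_
      rintro _ ⟨S, f, y, h, rfl⟩
      rw [FI.card_iter] at h
      omega
    rw [h₀]
    constructor
    · rintro ⟨y, hy⟩
      exact hy.symm
    · intro hx
      exact ⟨0, Eq.symm hx⟩
  | succ n ih =>
    refine Iff.trans ?_ (mem_lower_shift_obj_iff V (FI.iter n) x).symm
    constructor
    · rintro ⟨⟨w, v⟩, hwv⟩
      have h₁ : koszulD n 1 _ w + koszulMap n 1 (toShift V) v =
        toKoszul n ((shift R).obj V) x := congrArg Prod.fst hwv
      obtain ⟨v, rfl⟩ := (toKoszul_bijective n V).2 v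
      obtain ⟨t, ht⟩ := (toKoszul_bijective n _).2 (koszulD n 1 ((shift R).obj V) w)
      rw [koszulMap_toKoszul, ← ht, ← map_add] at h₁
      refine ⟨t, (ih _ _).1 ⟨w, ht.symm⟩, v, (toKoszul_bijective n _).1 h₁⟩
    · rintro ⟨t, ht, v, rfl⟩
      obtain ⟨w, hw⟩ := (ih _ _).2 ht
      refine ⟨(w, toKoszul n V v), ?_⟩
      refine Prod.ext ?_ (Subsingleton.elim _ _)
      change koszulD n 1 _ w + koszulMap n 1 (toShift V) (toKoszul n V v) = _
      rw [koszulMap_toKoszul, hw]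
      exact (map_add (toKoszul n ((shift R).obj V)) _ _).symm

theorem koszulVanishes_zero_iff (n : ℕ) (V : FIModule.{u} R) :
    KoszulVanishes n 0 V ↔ V.lower (FI.iter n) = ⊤ := by
  rw [eq_top_iff]
  constructor
  · intro h x _
    exact (toKoszul_mem_range_iff n V x).1 (h _ (Subsingleton.elim _ _))
  · intro h x _
    obtain ⟨x, rfl⟩ := (toKoszul_bijective n V).2 x
    exact (toKoszul_mem_range_iff n V x).2 (h trivial)

/-! ### Vanishing of a module from vanishing of H₀. -/

/-- A Nakayama argument: in the least cardinality where V could be nonzero, nothing comes from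
smaller sets, so V equals H₀(V) there. -/
theorem subsingleton_obj_of_koszulVanishes_zero {V : FIModule.{u} R}
    (h : ∀ n, KoszulVanishes n 0 V) (T : FI) : Subsingleton (V.obj T) := by
  induction hn : Nat.card T using Nat.strong_induction_on generalizing T with
  | _ n ih =>
    have hb : V.lower (FI.iter n) = ⊥ := by
      refine Submodule.span_eq_bot.2 ?_
      rintro _ ⟨S, f, y, hS, rfl⟩
      rw [FI.card_iter] at hS
      rw [(ih _ hS S rfl).elim y 0, map_zero]
    have := (Submodule.subsingleton_iff R).1
      (subsingleton_of_bot_eq_top (hb.symm.trans ((koszulVanishes_zero_iff n V).1 (h n))))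
    exact subsingleton_obj_of_card_eq V (S := FI.iter n) ((FI.card_iter n).trans hn.symm)

/-- Every injection into a strictly larger set factors through some S → S ⊔ {∗}, which kills K. So
H₀(K) = K. -/
theorem subsingleton_obj_of_koszulVanishes_ker {n : ℕ} {K V : FIModule.{u} R} {i : K ⟶ V}
    (his : ∀ T, Function.Injective (i.app T))
    (hi : ∀ T, Function.Exact (i.app T) ((toShift V).app T))
    (h : KoszulVanishes n 0 K) (T : FI) (hT : Nat.card T = n) : Subsingleton (K.obj T) := by
  have hb : K.lower (FI.iter n) = ⊥ := by
    refine Submodule.span_eq_bot.2 ?_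
    rintro _ ⟨S, f, y, hS, rfl⟩
    obtain ⟨g, rfl⟩ := FI.exists_eq_incl_comp f hS
    apply his
    refine (NatTrans.naturality_apply i _ y).trans ?_
    refine (map_comp_hom_apply V _ _ _).trans ?_
    refine (congrArg (V.map g).hom ((hi S).apply_apply_eq_zero y)).trans ?_
    rw [map_zero, map_zero]
  have := (Submodule.subsingleton_iff R).1
    (subsingleton_of_bot_eq_top (hb.symm.trans ((koszulVanishes_zero_iff n K).1 h)))
  exact subsingleton_obj_of_card_eq K (S := FI.iter n) ((FI.card_iter n).trans hT.symm)

/-! ### Free modules and their shifts. -/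

section Free

variable (R) in
/-- The direct sum of the FI-modules `R[Hom(A i, -)]`. -/
noncomputable def freeOn {ι : Type u} (A : ι → Type) : FIModule.{u} R where
  obj T := ModuleCat.of R ((Σ i, A i ↪ T) →₀ R)
  map {T T'} g := ModuleCat.ofHom
    (Finsupp.lmapDomain R R (fun a => ⟨a.1, a.2.trans g⟩))
  map_id T := by
    ext a
    simp only [ModuleCat.hom_ofHom, LinearMap.comp_apply, Finsupp.lsingle_apply,
      Finsupp.lmapDomain_apply, Finsupp.mapDomain_single]
    rfl
  map_comp f g := by
    ext a
    simp only [ModuleCat.hom_ofHom, LinearMap.comp_apply, Finsupp.lsingle_apply,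
      Finsupp.lmapDomain_apply, Finsupp.mapDomain_single, ModuleCat.hom_comp]
    rfl

theorem freeOn_map_single {ι : Type u} (A : ι → Type) {T T' : FI} (g : T ⟶ T') (i : ι)
    (f : A i ↪ T) (c : R) :
    ((freeOn R A).map g).hom (Finsupp.single ⟨i, f⟩ c) =
      Finsupp.single (⟨i, f.trans g⟩ : Σ i, A i ↪ T') c :=
  Finsupp.mapDomain_single

variable {ι : Type u} {A : ι → Type}

variable (A) in
/-- The sets obtained from the `A i` by removing one point. -/
abbrev removePoint (a : Σ i, A i) : Type := {x : A a.1 // x ≠ a.2}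

open Classical in
/-- Extend an injection by sending the removed point to the added point. -/
noncomputable def extendEmbedding {B T : Type} (a : B) (f : {x : B // x ≠ a} ↪ T) :
    B ↪ Option T :=
  (Equiv.optionSubtypeNe a).symm.toEmbedding.trans f.optionMap

theorem extendEmbedding_self {B T : Type} (a : B) (f : {x : B // x ≠ a} ↪ T) :
    extendEmbedding a f a = none := by
  simp [extendEmbedding]

theorem extendEmbedding_of_ne {B T : Type} (a : B) (f : {x : B // x ≠ a} ↪ T)
    (x : {x : B // x ≠ a}) : extendEmbedding a f x = some (f x) := by
  simp [extendEmbedding, x.2]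

/-- Extend the injections of a family by sending the removed points to the added point. -/
noncomputable def extendPoint (T : Type) (b : Σ a, removePoint A a ↪ T) : Σ i, A i ↪ Option T :=
  ⟨b.1.1, extendEmbedding b.1.2 b.2⟩

theorem extendPoint_injective (T : Type) :
    Function.Injective (extendPoint (A := A) T) := by
  rintro ⟨⟨i, a⟩, f⟩ ⟨⟨j, b⟩, g⟩ h
  obtain rfl : i = j := congrArg Sigma.fst h
  have h' : extendEmbedding a f = extendEmbedding b g := eq_of_heq (Sigma.mk.inj h).2
  obtain rfl : a = b := by
    apply (extendEmbedding a f).injective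
    rw [extendEmbedding_self, h', extendEmbedding_self]
  congr 1
  ext x
  have := DFunLike.congr_fun h' x.1
  rw [extendEmbedding_of_ne, extendEmbedding_of_ne] at this
  exact Option.some.inj this

/-- Regard an injection into `T` as one into `T ⊔ {∗}`. -/
def composeSome (T : Type) (b : Σ i, A i ↪ T) : Σ i, A i ↪ Option T :=
  ⟨b.1, b.2.trans Function.Embedding.some⟩

theorem composeSome_injective (T : Type) : Function.Injective (composeSome (A := A) T) := by
  rintro ⟨i, f⟩ ⟨j, g⟩ h
  obtain rfl : i = j := congrArg Sigma.fst h
  have h' := eq_of_heq (Sigma.mk.inj h).2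
  congr 1
  ext x
  exact Option.some.inj (congrArg (fun e => e x) h')

theorem composeSome_ne_extendPoint (T : Type) (b : Σ i, A i ↪ T)
    (b' : Σ a, removePoint A a ↪ T) : composeSome T b ≠ extendPoint T b' := by
  obtain ⟨i, f⟩ := b
  intro h
  obtain ⟨⟨j, a⟩, g⟩ := b'
  obtain rfl : i = j := congrArg Sigma.fst h
  have h' : f.trans Function.Embedding.some = extendEmbedding a g :=
    eq_of_heq (Sigma.mk.inj h).2
  exact Option.some_ne_none _ ((DFunLike.congr_fun h' a).trans (extendEmbedding_self a g))

/-- The basis of the shifted free module splits: injections missing ∗ form the image of the original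
module, and those hitting ∗ are a basis of the cokernel, indexed by the preimage of ∗ and the
remaining injection. -/
theorem exists_composeSome_or_extendPoint (T : Type) (c : Σ i, A i ↪ Option T) :
    (∃ b, composeSome T b = c) ∨ ∃ b, extendPoint T b = c := by
  obtain ⟨i, f⟩ := c
  by_cases h : ∃ a, f a = none
  · right
    obtain ⟨a, ha⟩ := h
    have hsome : ∀ x : {x // x ≠ a}, ∃ t, f x = some t := fun x =>
      Option.ne_none_iff_exists'.1 fun hx => x.2 (f.injective (hx.trans ha.symm))
    choose g hg using hsome
    refine ⟨⟨⟨i, a⟩, ⟨g, fun x y hxy => Subtype.ext (f.injective (by rw [hg, hg, hxy]))⟩⟩,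
      Sigma.ext rfl (heq_of_eq (Function.Embedding.ext fun x => ?_))⟩
    by_cases hx : x = a
    · rw [hx]
      exact (extendEmbedding_self _ _).trans ha.symm
    · exact (extendEmbedding_of_ne _ _ ⟨x, hx⟩).trans (hg ⟨x, hx⟩).symm
  · left
    push Not at h
    have hsome : ∀ x, ∃ t, f x = some t := fun x => Option.ne_none_iff_exists'.1 (h x)
    choose g hg using hsome
    refine ⟨⟨i, ⟨g, fun x y hxy => f.injective (by rw [hg, hg, hxy])⟩⟩, ?_⟩
    refine Sigma.ext rfl (heq_of_eq ?_)
    ext1 x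
    exact (hg x).symm

theorem extendPoint_trans {T T' : Type} (g : T ↪ T') (b : Σ a, removePoint A a ↪ T) :
    (⟨(extendPoint T b).1, (extendPoint T b).2.trans g.optionMap⟩ : Σ i, A i ↪ Option T') =
      extendPoint T' ⟨b.1, b.2.trans g⟩ := by
  refine Sigma.ext rfl (heq_of_eq ?_)
  ext1 x
  change Option.map g (Option.map b.2 _) = Option.map (b.2.trans g) _
  rw [Option.map_map]
  rfl

theorem comapDomain_extendPoint_single_composeSome (T : Type) (b : Σ i, A i ↪ T) (c : R) :
    Finsupp.lcomapDomain (R := R) _ (extendPoint_injective T)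
      (Finsupp.single (composeSome T b) c) = 0 := by
  ext b'
  exact Finsupp.single_eq_of_ne (composeSome_ne_extendPoint T b b').symm

theorem comapDomain_extendPoint_single_extendPoint (T : Type) (b : Σ a, removePoint A a ↪ T)
    (c : R) :
    Finsupp.lcomapDomain (R := R) _ (extendPoint_injective T)
      (Finsupp.single (extendPoint T b) c) = Finsupp.single b c := by
  ext b'
  change Finsupp.single (extendPoint T b) c (extendPoint T b') = _
  exact Finsupp.single_apply_left (extendPoint_injective T) b b' c

variable (R A) in
/-- The projection from the shift of a free FI-module to the free summand complementary to the
image of the FI-module. -/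
noncomputable def shiftFreeProj :
    (shift R).obj (freeOn R A) ⟶ freeOn R (removePoint A) where
  app T := ModuleCat.ofHom (Finsupp.lcomapDomain _ (extendPoint_injective T))
  naturality {T T'} g := by
    apply ModuleCat.hom_ext
    refine Finsupp.lhom_ext' fun c => LinearMap.ext_ring ?_
    change Finsupp.lcomapDomain (R := R) _ (extendPoint_injective T')
        (((freeOn R A).map (FI.shift.map g)).hom (Finsupp.single c 1)) =
      ((freeOn R (removePoint A)).map g).hom
        (Finsupp.lcomapDomain (R := R) _ (extendPoint_injective T) (Finsupp.single c 1))
    rw [freeOn_map_single]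
    rcases exists_composeSome_or_extendPoint T c with ⟨b, rfl⟩ | ⟨b, rfl⟩
    · rw [comapDomain_extendPoint_single_composeSome]
      refine Eq.trans ?_ (map_zero ((freeOn R (removePoint A)).map g).hom).symm
      exact comapDomain_extendPoint_single_composeSome T' ⟨b.1, b.2.trans g⟩ 1
    · rw [comapDomain_extendPoint_single_extendPoint, freeOn_map_single]
      refine Eq.trans ?_ (comapDomain_extendPoint_single_extendPoint T' ⟨b.1, b.2.trans g⟩ 1)
      rw [← extendPoint_trans]
      rfl

theorem toShift_freeOn_injective (T : FI) :
    Function.Injective ((toShift (freeOn R A)).app T) :=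
  Finsupp.mapDomain_injective (composeSome_injective T)

theorem shiftFreeProj_surjective (T : FI) :
    Function.Surjective ((shiftFreeProj R A).app T) := fun x =>
  ⟨Finsupp.mapDomain (extendPoint T) x,
    Finsupp.comapDomain_mapDomain _ (extendPoint_injective T) x⟩

theorem toShift_shiftFreeProj_exact (T : FI) :
    Function.Exact ((toShift (freeOn R A)).app T) ((shiftFreeProj R A).app T) := by
  intro x
  constructor
  · intro hx
    refine ⟨Finsupp.comapDomain (composeSome T) x (composeSome_injective T).injOn, ?_⟩
    refine Finsupp.mapDomain_comapDomain _ (composeSome_injective T) x ?_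
    intro c hc
    rcases exists_composeSome_or_extendPoint T c with h | ⟨b, rfl⟩
    · exact h
    · exact absurd (DFunLike.congr_fun (F := _ →₀ R) hx b)
        (Finsupp.mem_support_iff (f := (x : _ →₀ R)).1 hc)
  · rintro ⟨y, rfl⟩
    refine Finsupp.ext fun b => ?_
    exact Finsupp.mapDomain_of_notMem_range _ _ fun ⟨c, hc⟩ => composeSome_ne_extendPoint T c b hc

end Free

/-- The family `A` is general because the induction on n replaces it by `removePoint A`, which
indexes the free cokernel; the kernel is zero. -/
theorem koszulVanishes_freeOn (n p : ℕ) {ι : Type u} (A : ι → Type) :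
    KoszulVanishes n (p + 1) (freeOn R A) := by
  induction n generalizing p ι with
  | zero => exact koszulVanishes_of_subsingleton inferInstance
  | succ n ih =>
    let K : FIModule.{u} R := (Functor.const FI).obj (ModuleCat.of R PUnit)
    have hK : ∀ T, Subsingleton (K.obj T) := fun T => inferInstanceAs (Subsingleton PUnit)
    refine KoszulVanishes.succ_of_ker_of_coker (K := K) (i := 0) (q := shiftFreeProj R A)
      (fun T => Function.injective_of_subsingleton _) (fun T x => ?_) shiftFreeProj_surjective
      toShift_shiftFreeProj_exact (ih p _)
      (koszulVanishes_of_subsingleton (koszul_subsingleton n p K fun T _ => hK T))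
    constructor
    · intro hx
      exact ⟨0, (toShift_freeOn_injective T (hx.trans (map_zero _).symm)).symm⟩
    · rintro ⟨y, rfl⟩
      exact map_zero _

/-! ### Acyclicity of projectives. -/

/-- A free cover is a direct sum of representable FI-modules. -/
noncomputable def freeCoverToFreeOn (W : FIModule.{u} R) :
    freeCover W ⟶ freeOn R (fun a : Σ n : ℕ, W.obj (FI.std n) => Fin a.1) where
  app T := ModuleCat.ofHom (Finsupp.lmapDomain R R fun a => ⟨⟨a.1, a.2.1⟩, a.2.2⟩)
  naturality {T T'} g := by
    apply ModuleCat.hom_ext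
    refine Finsupp.lhom_ext' fun a => LinearMap.ext_ring ?_
    change Finsupp.mapDomain _ (Finsupp.mapDomain _ (Finsupp.single a 1)) =
      Finsupp.mapDomain _ (Finsupp.mapDomain _ (Finsupp.single a 1))
    simp only [Finsupp.mapDomain_single]
    rfl

/-- The inverse of `freeCoverToFreeOn`. -/
noncomputable def freeOnToFreeCover (W : FIModule.{u} R) :
    freeOn R (fun a : Σ n : ℕ, W.obj (FI.std n) => Fin a.1) ⟶ freeCover W where
  app T := ModuleCat.ofHom (Finsupp.lmapDomain R R fun a => ⟨a.1.1, a.1.2, a.2⟩)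
  naturality {T T'} g := by
    apply ModuleCat.hom_ext
    refine Finsupp.lhom_ext' fun a => LinearMap.ext_ring ?_
    change Finsupp.mapDomain _ (Finsupp.mapDomain _ (Finsupp.single a 1)) =
      Finsupp.mapDomain _ (Finsupp.mapDomain _ (Finsupp.single a 1))
    simp only [Finsupp.mapDomain_single]
    rfl

theorem freeCoverToFreeOn_comp (W : FIModule.{u} R) :
    freeCoverToFreeOn W ≫ freeOnToFreeCover W = 𝟙 _ := by
  ext T : 2
  apply ModuleCat.hom_ext
  refine Finsupp.lhom_ext' fun a => LinearMap.ext_ring ?_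
  change Finsupp.mapDomain _ (Finsupp.mapDomain _ (Finsupp.single a 1)) = Finsupp.single a 1
  simp only [Finsupp.mapDomain_single]

theorem freeCoverLift_epi (W : FIModule.{u} R) : Epi (freeCoverLift W W fun _ w => w) := by
  have : ∀ T, Epi ((freeCoverLift W W fun _ w => w).app T) := by
    intro T
    rw [ModuleCat.epi_iff_surjective]
    intro x
    obtain ⟨n, ⟨i⟩⟩ := exists_iso_std T
    refine ⟨Finsupp.single ⟨n, (W.map i.inv).hom x, i.hom⟩ 1, ?_⟩
    refine (freeCoverLift_single W W _ _ _ _).trans ?_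
    exact ConcreteCategory.congr_hom (W.mapIso i).inv_hom_id x
  exact NatTrans.epi_of_epi_app _

theorem koszulVanishes_of_projective (n p : ℕ) (P : FIModule.{u} R) [Projective P] :
    KoszulVanishes n (p + 1) P := by
  have := freeCoverLift_epi P
  exact ((koszulVanishes_freeOn n p _).of_retract _ _ (freeCoverToFreeOn_comp P)).of_retract
    (Projective.factorThru (𝟙 P) (freeCoverLift P P fun _ w => w)) _
    (Projective.factorThru_comp _ _)

/-! ### Comparison with the derived functors of H₀. -/

theorem app_injective_of_mono {X Y : FIModule.{u} R} (i : X ⟶ Y) [Mono i] (T : FI) :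
    Function.Injective (i.app T) :=
  (ModuleCat.mono_iff_injective _).1 inferInstance

theorem app_exact_of_exact {S : ShortComplex (FIModule.{u} R)} (h : S.Exact) (T : FI) :
    Function.Exact (S.f.app T) (S.g.app T) :=
  (ShortComplex.ShortExact.moduleCat_exact_iff_function_exact _).1
    (h.map ((evaluation FI (ModuleCat.{u} R)).obj T))

theorem exists_mem_lower_of_surjective {V W : FIModule.{u} R} {φ : V ⟶ W}
    (h : ∀ T, Function.Surjective (φ.app T)) (T : FI) {w : W.obj T} (hw : w ∈ W.lower T) :
    ∃ v ∈ V.lower T, (φ.app T).hom v = w := by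
  have : W.lower T ≤ (V.lower T).map (φ.app T).hom := by
    refine Submodule.span_le.2 ?_
    rintro _ ⟨S, f, y, hS, rfl⟩
    obtain ⟨x, rfl⟩ := h S y
    exact ⟨(V.map f).hom x, map_mem_lower V f hS x, NatTrans.naturality_apply φ f x⟩
  exact this hw

/-- Exactness at the middle of `H₀(A)_T → H₀(B)_T → H₀(C)_T`, in terms of elements. -/
def H0ExactAt {A B C : FIModule.{u} R} (f : A ⟶ B) (g : B ⟶ C) (T : FI) : Prop :=
  ∀ x : B.obj T, (g.app T).hom x ∈ C.lower T → ∃ y : A.obj T, x - (f.app T).hom y ∈ B.lower T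

/-- The image of `g` is the first syzygy Z of X. By right exactness, H₀(Z) is the cokernel of H₀(A)
→ H₀(B), so injectivity of H₀(Z) → H₀(C) is exactness at H₀(B). -/
theorem koszulVanishes_one_iff_H0ExactAt {A B C X : FIModule.{u} R} {f : A ⟶ B} {g : B ⟶ C}
    {π : C ⟶ X} (n : ℕ) (hf : ∀ T, Function.Exact (f.app T) (g.app T))
    (hg : ∀ T, Function.Exact (g.app T) (π.app T)) (hπ : ∀ T, Function.Surjective (π.app T))
    (hC : ∀ p, KoszulVanishes n (p + 1) C) :
    KoszulVanishes n 1 X ↔ H0ExactAt f g (FI.iter n) := by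
  have hfac : ∀ T x, (Limits.image.ι g).app T ((Limits.factorThruImage g).app T x) =
      g.app T x := fun T x => by
    rw [← ConcreteCategory.comp_apply, ← NatTrans.comp_app, Limits.image.fac]
  have hi := app_injective_of_mono (Limits.image.ι g)
  have he := app_surjective_of_epi (Limits.factorThruImage g)
  rw [koszulVanishes_one_iff (i := Limits.image.ι g) hi (fun T x => ?_) hπ hC]
  · constructor
    · intro h x hx
      have h₁ := h (toKoszul n _ ((Limits.factorThruImage g).app _ x)) (by
        rw [koszulMap_toKoszul, toKoszul_mem_range_iff]
        exact (hfac _ x).symm ▸ hx)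
      rw [toKoszul_mem_range_iff] at h₁
      obtain ⟨b, hb, hbx⟩ := exists_mem_lower_of_surjective he _ h₁
      obtain ⟨y, hy⟩ := (hf _ (x - b)).1 (by
        rw [← hfac, map_sub, sub_eq_zero.2 hbx.symm, map_zero])
      refine ⟨y, ?_⟩
      rw [show (f.app _).hom y = x - b from hy, sub_sub_cancel]
      exact hb
    · intro h z hz
      obtain ⟨z, rfl⟩ := (toKoszul_bijective n _).2 z
      rw [koszulMap_toKoszul, toKoszul_mem_range_iff] at hz
      rw [toKoszul_mem_range_iff]
      obtain ⟨x, rfl⟩ := he _ z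
      obtain ⟨y, hy⟩ := h x (by
        rw [← show _ = (g.app _).hom x from hfac _ x]; exact hz)
      have h₀ : (Limits.factorThruImage g).app _ (f.app _ y) = 0 := by
        apply hi
        rw [hfac, (hf _).apply_apply_eq_zero, map_zero]
      have h₁ := lower_le_comap_app (Limits.factorThruImage g) _ hy
      rw [Submodule.mem_comap, map_sub] at h₁
      erw [h₀, sub_zero] at h₁
      exact h₁
  · rw [hg T x]
    constructor
    · rintro ⟨y, rfl⟩
      exact ⟨_, hfac T y⟩
    · rintro ⟨y, rfl⟩
      obtain ⟨z, rfl⟩ := he T y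
      exact ⟨z, (hfac T z).symm⟩

/-- Replacing X by its first syzygy and dropping the first term of the resolution lowers the
homological degree by one, down to degree one. -/
theorem koszulVanishes_succ_iff_H0ExactAt (n q : ℕ) {X : FIModule.{u} R}
    (Q : ℕ → FIModule.{u} R) (d : ∀ q, Q (q + 1) ⟶ Q q) (π : Q 0 ⟶ X)
    (hπ : ∀ T, Function.Surjective (π.app T))
    (hd₀ : ∀ T, Function.Exact ((d 0).app T) (π.app T))
    (hd : ∀ q T, Function.Exact ((d (q + 1)).app T) ((d q).app T))
    (hQ : ∀ q p, KoszulVanishes n (p + 1) (Q q)) :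
    KoszulVanishes n (q + 1) X ↔ H0ExactAt (d (q + 1)) (d q) (FI.iter n) := by
  induction q generalizing X Q with
  | zero => exact koszulVanishes_one_iff_H0ExactAt n (hd 0) hd₀ hπ (hQ 0)
  | succ q ih =>
    have hfac : ∀ T x, (Limits.image.ι (d 0)).app T ((Limits.factorThruImage (d 0)).app T x) =
        (d 0).app T x := fun T x => by
      rw [← ConcreteCategory.comp_apply, ← NatTrans.comp_app, Limits.image.fac]
    have hi := app_injective_of_mono (Limits.image.ι (d 0))
    have he := app_surjective_of_epi (Limits.factorThruImage (d 0))
    rw [koszulVanishes_succ_iff (i := Limits.image.ι (d 0)) hi (fun T x => ?_) hπ (hQ 0)]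
    · refine ih (fun q => Q (q + 1)) (fun q => d (q + 1)) (Limits.factorThruImage (d 0)) he
        (fun T x => ?_) (fun q => hd (q + 1)) (fun q => hQ (q + 1))
      rw [← hd 0 T x, ← hfac, map_eq_zero_iff _ (hi T)]
    · rw [hd₀ T x]
      constructor
      · rintro ⟨y, rfl⟩
        exact ⟨_, hfac T y⟩
      · rintro ⟨y, rfl⟩
        obtain ⟨z, rfl⟩ := he T y
        exact ⟨z, (hfac T z).symm⟩

theorem exact_map_H0_iff {A B C : FIModule.{u} R} (f : A ⟶ B) (g : B ⟶ C) (T : FI)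
    (w : (H0 R).map f ≫ (H0 R).map g = 0) :
    ((ShortComplex.mk _ _ w).map ((evaluation FI (ModuleCat.{u} R)).obj T)).Exact ↔
      H0ExactAt f g T := by
  rw [ShortComplex.moduleCat_exact_iff]
  constructor
  · intro h x hx
    obtain ⟨y, hy⟩ := h (Submodule.Quotient.mk x) ((Submodule.Quotient.mk_eq_zero _).2 hx)
    obtain ⟨y, rfl⟩ := Submodule.Quotient.mk_surjective _ y
    exact ⟨y, (Submodule.Quotient.eq _).1 hy.symm⟩
  · intro h x hx
    obtain ⟨x, rfl⟩ := Submodule.Quotient.mk_surjective _ x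
    obtain ⟨y, hy⟩ := h x ((Submodule.Quotient.mk_eq_zero _).1 hx)
    exact ⟨Submodule.Quotient.mk y, ((Submodule.Quotient.eq _).2 hy).symm⟩

theorem subsingleton_H_obj_iff (q n : ℕ) (V : FIModule.{u} R) :
    Subsingleton (((H R (q + 1)).obj V).obj (FI.iter n)) ↔ KoszulVanishes n (q + 1) V := by
  let P := projectiveResolution V
  have hd : ∀ q T, Function.Exact ((P.complex.d (q + 2) (q + 1)).app T)
      ((P.complex.d (q + 1) q).app T) := fun q T => app_exact_of_exact (P.exact_succ q) T
  have hd₀ : ∀ T, Function.Exact ((P.complex.d 1 0).app T) ((P.π.f 0).app T) := fun T =>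
    app_exact_of_exact P.exact₀ T
  have hπ : ∀ T, Function.Surjective ((P.π.f 0).app T) := app_surjective_of_epi _
  rw [koszulVanishes_succ_iff_H0ExactAt n q (X := V) P.complex.X (fun q => P.complex.d (q + 1) q)
    (P.π.f 0) hπ hd₀ hd fun q p => koszulVanishes_of_projective n p _]
  have w : (H0 R).map (P.complex.d (q + 2) (q + 1)) ≫ (H0 R).map (P.complex.d (q + 1) q) = 0 := by
    rw [← Functor.map_comp, HomologicalComplex.d_comp_d, Functor.map_zero]
  rw [← exact_map_H0_iff _ _ _ w, ShortComplex.exact_iff_isZero_homology,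
    ← ModuleCat.isZero_iff_subsingleton]
  let C := ((H0 R).mapHomologicalComplex (ComplexShape.down ℕ)).obj P.complex
  let E := (evaluation FI (ModuleCat.{u} R)).obj (FI.iter n)
  have e₁ : (H R (q + 1)).obj V ≅ C.homology (q + 1) := P.isoLeftDerivedObj (H0 R) (q + 1)
  have e₂ : C.homology (q + 1) ≅ (ShortComplex.mk _ _ w).homology :=
    ShortComplex.homologyMapIso (C.isoSc' (q + 2) (q + 1) q (by simp) (by simp))
  exact (E.mapIso (e₁ ≪≫ e₂) ≪≫ ((ShortComplex.mk _ _ w).mapHomologyIso E).symm).isZero_iff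

/-! ### The induction proving the regularity bound. -/

/-- The regularity bound for the Koszul homology, with `deg H₀(V) < k` and `deg H₁(V) ≤ d`. -/
theorem koszulVanishes_of_le (k d : ℕ) (V : FIModule.{u} R)
    (h0 : ∀ n, k ≤ n → KoszulVanishes n 0 V) (h1 : ∀ n, d < n → KoszulVanishes n 1 V)
    (p n : ℕ) (h : d = 0 ∨ k = 0 ∨ p + 1 + k + d ≤ n + 1) : KoszulVanishes n (p + 1) V := by
  induction k generalizing d V p n with
  | zero =>
    exact koszulVanishes_of_subsingleton (koszul_subsingleton n _ V fun T _ =>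
      subsingleton_obj_of_koszulVanishes_zero (fun n => h0 n n.zero_le) T)
  | succ k ih =>
    cases n with
    -- In cardinality zero the complex sits in degree zero only. This is why `d = 0` already forces
    -- vanishing of all positive homology.
    | zero => exact koszulVanishes_of_subsingleton inferInstance
    | succ n =>
      let i := Limits.kernel.ι (toShift V)
      let q := Limits.cokernel.π (toShift V)
      have his : ∀ T, Function.Injective (i.app T) := app_injective_of_mono i
      have hqs : ∀ T, Function.Surjective (q.app T) := app_surjective_of_epi q
      have hi : ∀ T, Function.Exact (i.app T) ((toShift V).app T) := fun T =>
        app_exact_of_exact (ShortComplex.exact_kernel (toShift V)) T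
      have hq : ∀ T, Function.Exact ((toShift V).app T) (q.app T) := fun T =>
        app_exact_of_exact (ShortComplex.exact_cokernel (toShift V)) T
      -- Truncation of `d - 1` at zero is harmless, since the case `d = 0` asserts vanishing in
      -- every cardinality.
      have hD : ∀ p n, d - 1 = 0 ∨ k = 0 ∨ p + 1 + k + (d - 1) ≤ n + 1 →
          KoszulVanishes n (p + 1) (Limits.cokernel (toShift V)) :=
        ih (d - 1) _
          (fun n hn => koszulVanishes_zero_of_shift hqs hq (h0 (n + 1) (by omega)))
          (fun n hn => koszulVanishes_one_of_shift hqs hq (h1 (n + 1) (by omega)))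
      -- Only K_T with |T| = n - p matters. Outside the case `d = 0`, the hypothesis gives |T| ≥ k +
      -- d, just enough for H₁(V)_{|T|+1} and H₂(D)_{|T|} to vanish.
      refine KoszulVanishes.succ_of_ker_of_coker his hi hqs hq (hD p n (by omega))
        (koszulVanishes_of_subsingleton (koszul_subsingleton n p _ fun T hT => ?_))
      exact subsingleton_obj_of_koszulVanishes_ker his hi
        (koszulVanishes_ker_of_shift his hi hqs hq (h1 _ (by omega)) (hD 1 _ (by omega))) T rfl

/-! ### Translation to degrees. -/

theorem subsingleton_obj_of_deg_lt {W : FIModule.{u} R} {n : ℕ} (h : W.deg < n) :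
    Subsingleton (W.obj (FI.std n)) := by
  obtain ⟨k, hk, hkn⟩ := sInf_lt_iff.1 h
  exact hk n hkn

theorem deg_le_of_forall {W : FIModule.{u} R} {k : WithBot ℕ∞}
    (h : ∀ n : ℕ, k < n → Subsingleton (W.obj (FI.std n))) : W.deg ≤ k :=
  sInf_le h

theorem card_std (n : ℕ) : Nat.card (FI.std n) = n :=
  Nat.card_fin n

theorem subsingleton_obj_std_iff (W : FIModule.{u} R) (n : ℕ) :
    Subsingleton (W.obj (FI.std n)) ↔ Subsingleton (W.obj (FI.iter n)) :=
  ⟨fun _ => subsingleton_obj_of_card_eq W ((card_std n).trans (FI.card_iter n).symm),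
    fun _ => subsingleton_obj_of_card_eq W ((FI.card_iter n).trans (card_std n).symm)⟩

theorem koszulVanishes_zero_of_deg_lt {W : FIModule.{u} R} {n : ℕ}
    (h : ((H0 R).obj W).deg < n) : KoszulVanishes n 0 W :=
  (koszulVanishes_zero_iff n W).2 (Submodule.Quotient.subsingleton_iff.1
    ((subsingleton_obj_std_iff _ n).1 (subsingleton_obj_of_deg_lt h)))

theorem koszulVanishes_succ_of_deg_lt {W : FIModule.{u} R} {n p : ℕ}
    (h : ((H R (p + 1)).obj W).deg < n) : KoszulVanishes n (p + 1) W :=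
  (subsingleton_H_obj_iff p n W).1 ((subsingleton_obj_std_iff _ n).1
    (subsingleton_obj_of_deg_lt h))

theorem deg_H_succ_le {W : FIModule.{u} R} {k : WithBot ℕ∞} {p : ℕ}
    (h : ∀ n : ℕ, k < n → KoszulVanishes n (p + 1) W) : ((H R (p + 1)).obj W).deg ≤ k :=
  deg_le_of_forall fun n hn =>
    (subsingleton_obj_std_iff _ n).2 ((subsingleton_H_obj_iff p n W).2 (h n hn))

end FIModule

/-- The one is added on the left instead of subtracted on the right. If `k` or `d` is `⊥`, the right
side is `⊥`, which forces the degree to be `⊥`. -/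
theorem theoremA (W : FIModule.{u} ℤ) (k d : WithBot ℕ∞) (hk : k ≠ ⊤) (hd : d ≠ ⊤)
    (h0 : ((FIModule.H0 ℤ).obj W).deg ≤ k) (h1 : ((FIModule.H ℤ 1).obj W).deg ≤ d)
    (p : ℕ) (hp : 0 < p) :
    ((FIModule.H ℤ p).obj W).deg + 1 ≤ (p : WithBot ℕ∞) + k + d := by
  obtain ⟨p, rfl⟩ := Nat.exists_eq_add_of_le' hp
  have hk0 : ∀ n : ℕ, k < n → FIModule.KoszulVanishes n 0 W := fun n hn =>
    FIModule.koszulVanishes_zero_of_deg_lt (h0.trans_lt hn)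
  have hd1 : ∀ n : ℕ, d < n → FIModule.KoszulVanishes n 1 W := fun n hn =>
    FIModule.koszulVanishes_succ_of_deg_lt (h1.trans_lt hn)
  have cases_nat : ∀ a : WithBot ℕ∞, a ≠ ⊤ → a = ⊥ ∨ ∃ m : ℕ, a = m := by
    intro a ha
    induction a with
    | bot => exact Or.inl rfl
    | coe a =>
      induction a using ENat.recTopCoe with
      | top => exact absurd rfl ha
      | coe m => exact Or.inr ⟨m, rfl⟩
  have of_bot : (∀ n, FIModule.KoszulVanishes n (p + 1) W) →
      ((FIModule.H ℤ (p + 1)).obj W).deg + 1 ≤ ((p + 1 : ℕ) : WithBot ℕ∞) + k + d := by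
    intro h
    rw [le_bot_iff.1 (FIModule.deg_H_succ_le (k := ⊥) fun n _ => h n), WithBot.bot_add]
    exact bot_le
  rcases cases_nat d hd with rfl | ⟨d, rfl⟩
  · rcases cases_nat k hk with rfl | ⟨k, rfl⟩
    · exact of_bot fun n => FIModule.koszulVanishes_of_le 0 0 W
        (fun n _ => hk0 n (WithBot.bot_lt_coe _)) (fun n _ => hd1 n (WithBot.bot_lt_coe _)) p n
        (Or.inl rfl)
    -- The bound for H₀ is strict in `koszulVanishes_of_le`, hence `k + 1`; the value `0` stands in
    -- for `d = ⊥`.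
    · exact of_bot fun n => FIModule.koszulVanishes_of_le (k + 1) 0 W
        (fun n hn => hk0 n (by exact_mod_cast hn)) (fun n _ => hd1 n (WithBot.bot_lt_coe _)) p n
        (Or.inl rfl)
  · rcases cases_nat k hk with rfl | ⟨k, rfl⟩
    · exact of_bot fun n => FIModule.koszulVanishes_of_le 0 d W
        (fun n _ => hk0 n (WithBot.bot_lt_coe _)) (fun n hn => hd1 n (by exact_mod_cast hn)) p n
        (Or.inr (Or.inl rfl))
    · have key := FIModule.koszulVanishes_of_le (k + 1) d W
        (fun n hn => hk0 n (by exact_mod_cast hn)) (fun n hn => hd1 n (by exact_mod_cast hn)) p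
      have hle : ((FIModule.H ℤ (p + 1)).obj W).deg ≤ ((p + k + d : ℕ) : WithBot ℕ∞) :=
        FIModule.deg_H_succ_le fun n hn => key n (Or.inr (Or.inr (by
          have : p + k + d < n := by exact_mod_cast hn
          omega)))
      refine (add_le_add_left hle 1).trans (le_of_eq ?_)
      norm_cast
      omega
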